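/- Let $\mathfrak g$ be a finite-dimensional real Lie algebra and let $r\in\mathfrak g\wedge\mathfrak g$ be a classical $r$-matrix, i.e. $[\![r,r]\!]=0$, where $[\![\cdot,\cdot]\!]$ is the extension of the Lie bracket to a Gerstenhaber bracket on $\Lambda^\bullet\mathfrak g$. Let $\mathfrak g_r=\{(f\otimes \mathbb 1)r \mid f\in\mathfrak g^*\}$ be its symplectic subalgebra; it is a Lie subalgebra of $\mathfrak g$. (Here $x\wedge y$ is identified with $x\otimes y-y\otimes x$.) Let $(M,\omega)$ be a connected symplectic manifold, and let $\varphi$ be an action of $\mathfrak g$ on $M$, i.e. a homomorphism of Lie algebras from $\mathfrak g$ to the smooth vector fields on $M$. Suppose that $\varphi$ integrates to a smooth left action of a Lie group $G$ with Lie algebra $\mathfrak g$, i.e. $\varphi(\xi)_p=\frac{d}{dt}\big|_{t=0}\exp(-t\xi)\cdot p$ for all $\xi\in\mathfrak g$, $p\in M$. Let $\pi$ be the bivector field corresponding to $\omega$, that is $\pi_p(\omega_p(v,\cdot),\omega_p(w,\cdot))=\omega_p(v,w)$ for all $p\in M$ and $v,w\in T_pM$, and suppose that $\pi_p=(\varphi_p\wedge\varphi_p)(r)$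 for every $p\in M$, where $\varphi_p\colon\mathfrak g\to T_pM$, $\xi\mapsto\varphi(\xi)_p$. Then $M$ is a homogeneous space of the connected Lie subgroup $G_r$ with Lie algebra $\mathfrak g_r$. Precisely: 1. the connected Lie subgroup $G_r=\langle\exp\mathfrak g_r\rangle$ of $G$ acts transitively on $M$; 2. whenever $K$ is a connected Lie group and $\iota\colon K\to G$ is a smooth homomorphism whose differential at the identity is injective with image $\mathfrak g_r$ (for instance $K=G_r$ with its Lie group structure, or its universal covering group), the action $(k,p)\mapsto\iota(k)\cdot p$ of $K$ on $M$ is smooth and transitive, and all its orbit maps $K\to M$, $k\mapsto\iota(k)\cdot p$, are submersions. -/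

import Mathlib

open scoped Manifold ContDiff TensorProduct

noncomputable section

/-! ### Bivectors: the exterior square, contraction with covectors, and the Schouten bracket -/

section Algebra

variable {V : Type*} [AddCommGroup V] [Module ℝ V]

/-- The alternating map `(x, y) ↦ x ⊗ y - y ⊗ x`. -/
def wedgeTensorAlternating (V : Type*) [AddCommGroup V] [Module ℝ V] :
    V [⋀^Fin 2]→ₗ[ℝ] (V ⊗[ℝ] V) where
  toFun v := v 0 ⊗ₜ[ℝ] v 1 - v 1 ⊗ₜ[ℝ] v 0
  map_update_add' := by
    intro inst v i x y
    rw [Subsingleton.elim inst (instDecidableEqFin 2)]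
    fin_cases i <;> simp [TensorProduct.add_tmul, TensorProduct.tmul_add] <;> abel
  map_update_smul' := by
    intro inst v i c x
    rw [Subsingleton.elim inst (instDecidableEqFin 2)]
    fin_cases i <;>
      simp [TensorProduct.smul_tmul', TensorProduct.tmul_smul, smul_sub]
  map_eq_zero_of_eq' v i j h hij := by
    have h01 : v 0 = v 1 := by
      fin_cases i <;> fin_cases j <;> simp_all
    simp [h01]

/-- The inclusion of bivectors into tensors, `x ∧ y ↦ x ⊗ y - y ⊗ x`. -/
def bivectorToTensor (V : Type*) [AddCommGroup V] [Module ℝ V] : ⋀[ℝ]^2 V →ₗ[ℝ] V ⊗[ℝ] V :=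
  exteriorPower.alternatingMapLinearEquiv (wedgeTensorAlternating V)

theorem bivectorToTensor_ιMulti (v : Fin 2 → V) :
    bivectorToTensor V (exteriorPower.ιMulti ℝ 2 v) = v 0 ⊗ₜ[ℝ] v 1 - v 1 ⊗ₜ[ℝ] v 0 := by
  simp [bivectorToTensor, wedgeTensorAlternating]

/-- The contraction `(f ⊗ 𝟙) r` of a bivector `r ∈ V ∧ V` with a covector `f`. -/
def bivectorContract (r : ⋀[ℝ]^2 V) (f : Module.Dual ℝ V) : V :=
  TensorProduct.lid ℝ V (LinearMap.rTensor V f (bivectorToTensor V r))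

/-- The value `π(α, β)` of a bivector on two covectors,
so that `(X ∧ Y)(α, β) = α(X) β(Y) - α(Y) β(X)`. -/
def bivectorEval (π : ⋀[ℝ]^2 V) (α β : Module.Dual ℝ V) : ℝ :=
  β (bivectorContract π α)

variable {L : Type*} [LieRing L] [LieAlgebra ℝ L]

/-- The linear map `(x ⊗ y) ⊗ (z ⊗ w) ↦ [x, z] ∧ y ∧ w`. -/
def bracketWedge (L : Type*) [LieRing L] [LieAlgebra ℝ L] :
    (L ⊗[ℝ] L) ⊗[ℝ] (L ⊗[ℝ] L) →ₗ[ℝ] ExteriorAlgebra ℝ L :=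
  LinearMap.mul' ℝ (ExteriorAlgebra ℝ L) ∘ₗ
    TensorProduct.map
      (ExteriorAlgebra.ι ℝ ∘ₗ (LieModule.toModuleHom ℝ L L : L ⊗[ℝ] L →ₗ[ℝ] L))
      (LinearMap.mul' ℝ (ExteriorAlgebra ℝ L) ∘ₗ
        TensorProduct.map (ExteriorAlgebra.ι ℝ) (ExteriorAlgebra.ι ℝ)) ∘ₗ
    (TensorProduct.tensorTensorTensorComm ℝ L L L L).toLinearMap

/-- The Schouten bracket of two bivectors of a Lie algebra (the degree two part of the extension of
the Lie bracket to a Gerstenhaber bracket on the Grassmann algebra, which on decomposable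
bivectors is `⟦x₀ ∧ x₁, y₀ ∧ y₁⟧ = ∑ (-1)^(i+j) [xᵢ, yⱼ] ∧ x_(1-i) ∧ y_(1-j)`, see
`schoutenBracket_ιMulti`); its value lies in the third exterior power. -/
def schoutenBracket (r s : ⋀[ℝ]^2 L) : ExteriorAlgebra ℝ L :=
  bracketWedge L (bivectorToTensor L r ⊗ₜ[ℝ] bivectorToTensor L s)

theorem schoutenBracket_ιMulti (x y : Fin 2 → L) :
    schoutenBracket (exteriorPower.ιMulti ℝ 2 x) (exteriorPower.ιMulti ℝ 2 y) =
      ∑ i : Fin 2, ∑ j : Fin 2, (-1 : ℝ) ^ (i.val + j.val) •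
        (ExteriorAlgebra.ι ℝ ⁅x i, y j⁆ *
          (ExteriorAlgebra.ι ℝ (x (1 - i)) * ExteriorAlgebra.ι ℝ (y (1 - j)))) := by
  simp only [schoutenBracket, bivectorToTensor_ιMulti, Fin.sum_univ_two]
  simp [bracketWedge, TensorProduct.sub_tmul, TensorProduct.tmul_sub]
  abel

/-- A classical `r`-matrix: an element `r ∈ 𝔤 ∧ 𝔤` satisfying the classical Yang-Baxter
equation `⟦r, r⟧ = 0`. -/
def IsRMatrix (r : ⋀[ℝ]^2 L) : Prop :=
  schoutenBracket r r = 0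

theorem comm_bivectorToTensor (r : ⋀[ℝ]^2 L) :
    TensorProduct.comm ℝ L L (bivectorToTensor L r) = -bivectorToTensor L r := by
  have h : (TensorProduct.comm ℝ L L).toLinearMap ∘ₗ bivectorToTensor L = -bivectorToTensor L := by
    apply exteriorPower.linearMap_ext
    ext v
    simp [bivectorToTensor_ιMulti]
  exact LinearMap.congr_fun h r

/-- For an `r`-matrix `r`, the contractions `(f ⊗ 𝟙) r` are closed under the Lie bracket. -/
theorem exists_bivectorContract_eq_lie {r : ⋀[ℝ]^2 L} (hr : IsRMatrix r)
    (f g : Module.Dual ℝ L) :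
    ∃ k : Module.Dual ℝ L, bivectorContract r k = ⁅bivectorContract r f, bivectorContract r g⁆ := by
  obtain ⟨s, hs⟩ := TensorProduct.exists_finset (bivectorToTensor L r)
  have hc : ∀ k : Module.Dual ℝ L, bivectorContract r k = ∑ i ∈ s, k i.1 • i.2 := fun k => by
    simp [bivectorContract, hs, map_sum]
  have hc' : ∀ k : Module.Dual ℝ L, bivectorContract r k = -∑ i ∈ s, k i.2 • i.1 := fun k => by
    have h := comm_bivectorToTensor r
    rw [bivectorContract, ← neg_neg (bivectorToTensor L r), ← h, hs]
    simp [map_sum]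
  have h0 : ∑ i ∈ s, ∑ j ∈ s, ExteriorAlgebra.ι ℝ ⁅i.1, j.1⁆ *
      (ExteriorAlgebra.ι ℝ i.2 * ExteriorAlgebra.ι ℝ j.2) = 0 := by
    have h : schoutenBracket r r = 0 := hr
    rw [schoutenBracket, hs, TensorProduct.sum_tmul] at h
    simpa [TensorProduct.tmul_sum, bracketWedge, map_sum] using h
  have h1 : ∑ i ∈ s, ∑ j ∈ s,
      (f ⁅i.1, j.1⁆ • (g i.2 • j.2 - g j.2 • i.2)
        - f i.2 • (g ⁅i.1, j.1⁆ • j.2 - g j.2 • ⁅i.1, j.1⁆)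
        + f j.2 • (g ⁅i.1, j.1⁆ • i.2 - g i.2 • ⁅i.1, j.1⁆)) = (0 : L) := by
    apply (ExteriorAlgebra.ι_leftInverse (R := ℝ) (M := L)).injective
    have key : ∀ x y z : L, CliffordAlgebra.contractLeft (Q := (0 : QuadraticForm ℝ L)) g
        (CliffordAlgebra.contractLeft (Q := (0 : QuadraticForm ℝ L)) f
          (ExteriorAlgebra.ι ℝ x * (ExteriorAlgebra.ι ℝ y * ExteriorAlgebra.ι ℝ z))) =
        ExteriorAlgebra.ι ℝ (f x • (g y • z - g z • y) - f y • (g x • z - g z • x)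
          + f z • (g x • y - g y • x)) := by
      intro x y z
      simp only [ExteriorAlgebra.ι, CliffordAlgebra.contractLeft_ι_mul,
        CliffordAlgebra.contractLeft_ι, map_sub, map_smul, map_add, Algebra.algebraMap_eq_smul_one,
        mul_smul_comm, mul_one, mul_sub]
      module
    have h2 := congrArg (fun x => CliffordAlgebra.contractLeft (Q := (0 : QuadraticForm ℝ L)) g
      (CliffordAlgebra.contractLeft (Q := (0 : QuadraticForm ℝ L)) f x)) h0
    simp only [map_sum, map_zero, key] at h2 ⊢
    exact h2
  have e1 : ⁅bivectorContract r f, bivectorContract r g⁆ =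
      ∑ i ∈ s, ∑ j ∈ s, (f i.2 * g j.2) • ⁅i.1, j.1⁆ := by
    rw [hc' f, hc' g]
    rw [neg_lie, lie_neg, neg_neg, sum_lie]
    refine Finset.sum_congr rfl fun i _ => ?_
    rw [lie_sum]
    refine Finset.sum_congr rfl fun j _ => ?_
    rw [smul_lie, lie_smul, smul_smul]
  have e2 : ∑ i ∈ s, ∑ j ∈ s, (f j.2 * g i.2) • ⁅i.1, j.1⁆ =
      -∑ i ∈ s, ∑ j ∈ s, (f i.2 * g j.2) • ⁅i.1, j.1⁆ := by
    rw [Finset.sum_comm, ← Finset.sum_neg_distrib]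
    refine Finset.sum_congr rfl fun i _ => ?_
    rw [← Finset.sum_neg_distrib]
    refine Finset.sum_congr rfl fun j _ => ?_
    rw [← lie_skew, smul_neg]
  -- the remaining terms are contractions of `r`
  let k₁ : Module.Dual ℝ L := ∑ i ∈ s,
    (g i.2 • (f ∘ₗ (LieAlgebra.ad ℝ L i.1 : L →ₗ[ℝ] L)) -
      f i.2 • (g ∘ₗ (LieAlgebra.ad ℝ L i.1 : L →ₗ[ℝ] L)))
  have e3 : bivectorContract r k₁ = ∑ i ∈ s, ∑ j ∈ s,
      (f ⁅i.1, j.1⁆ * g i.2 - g ⁅i.1, j.1⁆ * f i.2) • j.2 := by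
    rw [hc, Finset.sum_comm]
    refine Finset.sum_congr rfl fun j _ => ?_
    rw [← Finset.sum_smul]
    congr 1
    simp only [k₁, LinearMap.sum_apply]
    refine Finset.sum_congr rfl fun i _ => ?_
    simp
    ring
  have e4 : ∑ i ∈ s, ∑ j ∈ s, (g ⁅i.1, j.1⁆ * f j.2 - f ⁅i.1, j.1⁆ * g j.2) • i.2 =
      ∑ i ∈ s, ∑ j ∈ s, (f ⁅i.1, j.1⁆ * g i.2 - g ⁅i.1, j.1⁆ * f i.2) • j.2 := by
    rw [Finset.sum_comm]
    refine Finset.sum_congr rfl fun i _ => Finset.sum_congr rfl fun j _ => ?_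
    rw [← lie_skew, map_neg, map_neg]
    congr 1
    ring
  have h2 : (2 : ℝ) • bivectorContract r k₁ +
      (2 : ℝ) • ⁅bivectorContract r f, bivectorContract r g⁆ = 0 := by
    rw [two_smul ℝ (bivectorContract r k₁), two_smul, e1]
    nth_rewrite 2 [e3]
    rw [← e4, e3, ← h1]
    nth_rewrite 2 [← neg_neg (∑ i ∈ s, ∑ j ∈ s, (f i.2 * g j.2) • ⁅i.1, j.1⁆)]
    rw [← e2, ← sub_eq_add_neg]
    simp only [← Finset.sum_add_distrib, ← Finset.sum_sub_distrib]
    refine Finset.sum_congr rfl fun i _ => Finset.sum_congr rfl fun j _ => ?_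
    module
  refine ⟨-k₁, ?_⟩
  have h3 : bivectorContract r (-k₁) = -bivectorContract r k₁ := by
    simp [hc]
  rw [h3, neg_eq_iff_add_eq_zero]
  have h4 : (2 : ℝ) • (bivectorContract r k₁ +
      ⁅bivectorContract r f, bivectorContract r g⁆) = 0 := by rw [smul_add, h2]
  exact (smul_eq_zero.mp h4).resolve_left two_ne_zero

/-- The symplectic subalgebra `𝔤_r = {(f ⊗ 𝟙) r | f ∈ 𝔤*}` of an `r`-matrix `r ∈ 𝔤 ∧ 𝔤`. -/
def symplecticSubalgebra (r : ⋀[ℝ]^2 L) (hr : IsRMatrix r) : LieSubalgebra ℝ L where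
  carrier := {x | ∃ f : Module.Dual ℝ L, bivectorContract r f = x}
  zero_mem' := ⟨0, by simp [bivectorContract]⟩
  add_mem' := by
    rintro _ _ ⟨f, rfl⟩ ⟨g, rfl⟩
    exact ⟨f + g, by simp [bivectorContract, LinearMap.rTensor_add]⟩
  smul_mem' := by
    rintro c _ ⟨f, rfl⟩
    exact ⟨c • f, by simp [bivectorContract, LinearMap.rTensor_smul]⟩
  lie_mem' := by
    rintro _ _ ⟨f, rfl⟩ ⟨g, rfl⟩
    exact exists_bivectorContract_eq_lie hr f g

end Algebra

/-! ### Symplectic manifolds -/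

section Symplectic

variable {E : Type*} [NormedAddCommGroup E] [NormedSpace ℝ E] {H : Type*} [TopologicalSpace H]
  (I : ModelWithCorners ℝ E H) {M : Type*} [TopologicalSpace M] [ChartedSpace H M]

/-- The expression, in the preferred chart at `x₀`, of a field of alternating 2-forms: its
pullback under the inverse of the chart (relevant only on the target of the chart). -/
def twoFormInChart (Ω : (p : M) → TangentSpace I p [⋀^Fin 2]→L[ℝ] ℝ) (x₀ : M) (y : E) :
    E [⋀^Fin 2]→L[ℝ] ℝ :=
  (Ω ((extChartAt I x₀).symm y)).compContinuousLinearMap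
    (mfderiv 𝓘(ℝ, E) I (extChartAt I x₀).symm y)

/-- A symplectic form on a manifold without boundary: a smooth, closed, nondegenerate 2-form.
Smoothness and closedness are expressed in the charts of the manifold. -/
structure IsSymplecticForm (Ω : (p : M) → TangentSpace I p [⋀^Fin 2]→L[ℝ] ℝ) : Prop where
  smooth : ∀ x₀ : M, ContDiffOn ℝ ∞ (twoFormInChart I Ω x₀) (extChartAt I x₀).target
  closed : ∀ x₀ : M, ∀ y ∈ (extChartAt I x₀).target, extDeriv (twoFormInChart I Ω x₀) y = 0
  nondegenerate : ∀ (p : M) (v : TangentSpace I p),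
    (∀ w : TangentSpace I p, Ω p ![v, w] = 0) → v = 0

variable {I}

theorem update_vec_two {V : Type*} (v w w' : V) : Function.update ![v, w] 1 w' = ![v, w'] := by
  ext i
  fin_cases i <;> rfl

/-- The covector `Ω(v, ·)`. -/
def twoFormFlat {p : M} (Ω : TangentSpace I p [⋀^Fin 2]→L[ℝ] ℝ) (v : TangentSpace I p) :
    Module.Dual ℝ (TangentSpace I p) where
  toFun w := Ω ![v, w]
  map_add' w w' := by
    simpa only [update_vec_two] using Ω.map_update_add ![v, 0] 1 w w'
  map_smul' c w := by
    simpa only [update_vec_two, RingHom.id_apply] using Ω.map_update_smul ![v, 0] 1 c w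

/-- `π` is the bivector field corresponding to the symplectic form `Ω`, that is
`π(Ω(v, ·), Ω(w, ·)) = Ω(v, w)` for all tangent vectors `v, w` at the same point.
As `v ↦ Ω(v, ·)` is bijective onto the cotangent space, this determines `π`. Equivalently,
`π(df, dg) = Ω(X_f, X_g)` for the Hamiltonian vector fields, `df = Ω(X_f, ·)`. -/
def IsBivectorOf (π : (p : M) → ⋀[ℝ]^2 (TangentSpace I p))
    (Ω : (p : M) → TangentSpace I p [⋀^Fin 2]→L[ℝ] ℝ) : Prop :=
  ∀ (p : M) (v w : TangentSpace I p),
    bivectorEval (π p) (twoFormFlat (Ω p) v) (twoFormFlat (Ω p) w) = Ω p ![v, w]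

end Symplectic

/-! ### Lie algebra actions, Lie group actions, homogeneous spaces -/

section Actions

variable {E : Type*} [NormedAddCommGroup E] [NormedSpace ℝ E] {H : Type*} [TopologicalSpace H]
  (I : ModelWithCorners ℝ E H) {M : Type*} [TopologicalSpace M] [ChartedSpace H M]
  {E' : Type*} [NormedAddCommGroup E'] [NormedSpace ℝ E'] {H' : Type*} [TopologicalSpace H']
  (J : ModelWithCorners ℝ E' H') {G : Type*} [TopologicalSpace G] [ChartedSpace H' G] [Group G]
  {L : Type*} [LieRing L] [LieAlgebra ℝ L]

/-- An action of the Lie algebra `L` on the manifold `M`: a homomorphism of Lie algebras from `L`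
to the smooth vector fields on `M`. -/
structure IsLieAlgebraAction [IsManifold I ∞ M]
    (φ : L →ₗ[ℝ] ((p : M) → TangentSpace I p)) : Prop where
  smooth : ∀ ξ : L, ContMDiff I I.tangent ∞ (fun p => (⟨p, φ ξ p⟩ : TangentBundle I M))
  map_lie : ∀ (ξ η : L) (p : M), φ ⁅ξ, η⁆ p = VectorField.mlieBracket I (φ ξ) (φ η) p

/-- The image `(φ ∧ φ)(r)` of a bivector `r ∈ L ∧ L` under `φ`, a bivector field on `M`. -/
def bivectorImage {I : ModelWithCorners ℝ E H} (φ : L →ₗ[ℝ] ((p : M) → TangentSpace I p))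
    (r : ⋀[ℝ]^2 L) (p : M) : ⋀[ℝ]^2 (TangentSpace I p) :=
  exteriorPower.map 2 (LinearMap.proj p ∘ₗ φ) r

/-- The Lie algebra action `φ` of `L` integrates to the smooth left action of the Lie group `G`,
whose Lie algebra is identified with `L` by the isomorphism `e`: the fundamental vector field of
`ξ` is `φ ξ (p) = d/dt exp(-tξ) • p` at `t = 0`. (For a left action, it is this choice of sign that
makes the fundamental vector fields a homomorphism of Lie algebras.) -/
structure IntegratesTo [MulAction G M] (φ : L →ₗ[ℝ] ((p : M) → TangentSpace I p))
    (e : L ≃ₗ[ℝ] GroupLieAlgebra J G) : Prop where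
  map_lie : ∀ ξ η : L, e ⁅ξ, η⁆ = ⁅e ξ, e η⁆
  contMDiff_smul : ContMDiff (J.prod I) I ∞ (fun q : G × M => q.1 • q.2)
  fundamental : ∀ (ξ : L) (p : M),
    (φ ξ p : E) = -(mfderiv J I (fun g : G => g • p) 1 (e ξ) : E)

/-- `g = exp ξ` in a Lie group: `g` is the value at time one of the integral curve, starting at the
identity, of the left-invariant vector field given by `ξ`. -/
def IsLieExp (ξ : GroupLieAlgebra J G) (g : G) : Prop :=
  ∃ γ : ℝ → G, γ 0 = 1 ∧ IsMIntegralCurve (I := J) γ (mulInvariantVectorField ξ) ∧ γ 1 = g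

/-- The (underlying group of the) connected Lie subgroup of `G` with Lie algebra `𝔥`: the subgroup
generated by `exp 𝔥`. -/
def connectedLieSubgroup (𝔥 : Submodule ℝ (GroupLieAlgebra J G)) : Subgroup G :=
  Subgroup.closure {g | ∃ ξ ∈ 𝔥, IsLieExp J ξ g}

/-- A homomorphism `ι : K → G` of Lie groups integrates the inclusion of the subalgebra `𝔥` into
the Lie algebra of `G`: it is smooth, and its differential at the identity is an isomorphism of
the Lie algebra of `K` onto `𝔥`. For connected `K` and injective `ι` this says that
`ι` makes `K` the connected (immersed) Lie subgroup of `G` with Lie algebra `𝔥`. -/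
structure IsIntegralOf {E'' : Type*} [NormedAddCommGroup E''] [NormedSpace ℝ E'']
    {H'' : Type*} [TopologicalSpace H''] (J' : ModelWithCorners ℝ E'' H'')
    {K : Type*} [TopologicalSpace K] [ChartedSpace H'' K] [Group K]
    (ι : K →* G) (𝔥 : Submodule ℝ (GroupLieAlgebra J G)) : Prop where
  contMDiff : ContMDiff J' J ∞ ι
  injective : Function.Injective (mfderiv J' J ι 1)
  range_eq : ∀ ξ : GroupLieAlgebra J G,
    ξ ∈ 𝔥 ↔ ∃ v : GroupLieAlgebra J' K, (mfderiv J' J ι 1 v : E') = ξ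

/-- `M` is a homogeneous space of the Lie group `G`: the action is smooth and transitive, and the
orbit maps `G → M` are submersions (so that they identify `M` with the quotient manifolds of `G`
by the stabilizers). -/
structure IsHomogeneousSpace (G M : Type*) [TopologicalSpace G] [ChartedSpace H' G] [Group G]
    [TopologicalSpace M] [ChartedSpace H M] [MulAction G M] : Prop where
  contMDiff_smul : ContMDiff (J.prod I) I ∞ (fun q : G × M => q.1 • q.2)
  transitive : ∀ p q : M, ∃ g : G, g • p = q
  submersion : ∀ (p : M) (g : G), Function.Surjective (mfderiv J I (fun h : G => h • p) g)

end Actions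

end

section

open Filter Set Topology

/-! ### The image of the symplectic subalgebra -/

section Algebra

/-! Contracting the bivector of `Ω` with the covector `Ω(v, ·)` returns `-v`, so contractions
exhaust each tangent space. Since the bivector is `(φ ∧ φ)(r)`, such a contraction is `φ` applied to
a contraction of `r`, that is, to an element of `𝔤_r`. Hence `𝔤_r` already spans every `T_pM`
(`exists_mem_symplecticSubalgebra_apply_eq`).

Infinitesimal transitivity makes orbits neighbourhoods of their points, and a connected space cut
into open orbits is a single orbit (`isPretransitive_of_orbit_mem_nhds`). For `K`, the orbit maps
are submersions at the identity, hence open there, and translation carries this to all of `K`. The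
subgroup generated by `exp 𝔤_r` carries no manifold structure here, so
`orbit_connectedLieSubgroup_mem_nhds` uses products of one-parameter subgroups, a map from some `ℝⁿ`
into that subgroup. -/

theorem bivectorToTensor_map {V W : Type*} [AddCommGroup V] [Module ℝ V] [AddCommGroup W]
    [Module ℝ W] (f : V →ₗ[ℝ] W) (r : ⋀[ℝ]^2 V) :
    bivectorToTensor W (exteriorPower.map 2 f r) = TensorProduct.map f f (bivectorToTensor V r) := by
  have h : bivectorToTensor W ∘ₗ exteriorPower.map 2 f =
      TensorProduct.map f f ∘ₗ bivectorToTensor V := by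
    apply exteriorPower.linearMap_ext
    ext v
    simp [bivectorToTensor_ιMulti]
  exact LinearMap.congr_fun h r

/-- Naturality, checked on pure tensors; it pulls a contraction on `T_pM` back to one on the Lie
algebra. -/
theorem bivectorContract_map {V W : Type*} [AddCommGroup V] [Module ℝ V] [AddCommGroup W]
    [Module ℝ W] (f : V →ₗ[ℝ] W) (r : ⋀[ℝ]^2 V) (α : Module.Dual ℝ W) :
    bivectorContract (exteriorPower.map 2 f r) α = f (bivectorContract r (α ∘ₗ f)) := by
  rw [bivectorContract, bivectorContract, bivectorToTensor_map]
  induction bivectorToTensor V r using TensorProduct.induction_on with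
  | zero => simp
  | tmul x y => simp
  | add x y hx hy => simp only [map_add, hx, hy]

variable {E : Type*} [NormedAddCommGroup E] [NormedSpace ℝ E] {H : Type*} [TopologicalSpace H]
  {I : ModelWithCorners ℝ E H} {M : Type*} [TopologicalSpace M] [ChartedSpace H M]

theorem twoForm_swap {p : M} (Ω : TangentSpace I p [⋀^Fin 2]→L[ℝ] ℝ) (v w : TangentSpace I p) :
    Ω ![v, w] = -Ω ![w, v] := by
  have h := Ω.toAlternatingMap.map_swap ![w, v] (i := 0) (j := 1) (by decide)
  have e : ![w, v] ∘ Equiv.swap (0 : Fin 2) 1 = ![v, w] := by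
    ext i
    fin_cases i <;> rfl
  rw [e] at h
  exact h

/-- Contraction of the bivector of a symplectic form with the covector `Ω(v, ·)` gives `-v`. -/
theorem IsBivectorOf.bivectorContract_twoFormFlat {π : (p : M) → ⋀[ℝ]^2 (TangentSpace I p)}
    {Ω : (p : M) → TangentSpace I p [⋀^Fin 2]→L[ℝ] ℝ} (hπ : IsBivectorOf π Ω)
    (hΩ : IsSymplecticForm I Ω) (p : M) (v : TangentSpace I p) :
    bivectorContract (π p) (twoFormFlat (Ω p) v) = -v := by
  set x := bivectorContract (π p) (twoFormFlat (Ω p) v) with hx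
  rw [eq_neg_iff_add_eq_zero]
  refine hΩ.nondegenerate p _ fun w => ?_
  have h : twoFormFlat (Ω p) w x = twoFormFlat (Ω p) v w := hπ p v w
  have h' : twoFormFlat (Ω p) w (x + v) = 0 := by
    rw [map_add, h]
    change Ω p ![v, w] + Ω p ![w, v] = 0
    rw [twoForm_swap (Ω p) v w, neg_add_cancel]
  rw [twoForm_swap]
  exact neg_eq_zero.mpr h'

theorem exists_mem_symplecticSubalgebra_apply_eq {L : Type*} [LieRing L] [LieAlgebra ℝ L]
    {r : ⋀[ℝ]^2 L} (hr : IsRMatrix r) {φ : L →ₗ[ℝ] ((p : M) → TangentSpace I p)}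
    {Ω : (p : M) → TangentSpace I p [⋀^Fin 2]→L[ℝ] ℝ} (hΩ : IsSymplecticForm I Ω)
    (hπ : IsBivectorOf (bivectorImage φ r) Ω) (p : M) (v : TangentSpace I p) :
    ∃ ξ ∈ symplecticSubalgebra r hr, φ ξ p = v := by
  -- The contraction negates, hence `-v`. The resulting `ξ` contracts `r` with the pullback of
  -- `Ω(-v, ·)` along `φ_p`.
  have h := hπ.bivectorContract_twoFormFlat hΩ p (-v)
  rw [bivectorImage, bivectorContract_map, neg_neg] at h
  exact ⟨_, ⟨_, rfl⟩, h⟩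

end Algebra

/-! ### Submersions are open -/

section Submersion

variable {E : Type*} [NormedAddCommGroup E] [NormedSpace ℝ E] [CompleteSpace E]
  {H : Type*} [TopologicalSpace H] {I : ModelWithCorners ℝ E H} [I.Boundaryless]
  {M : Type*} [TopologicalSpace M] [ChartedSpace H M]
  {E' : Type*} [NormedAddCommGroup E'] [NormedSpace ℝ E'] [CompleteSpace E']
  {H' : Type*} [TopologicalSpace H'] {J : ModelWithCorners ℝ E' H'} [J.Boundaryless]
  {N : Type*} [TopologicalSpace N] [ChartedSpace H' N]

/-- The open mapping property of a strictly differentiable map with surjective derivative, read in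
charts; without boundary, chart neighbourhoods are full neighbourhoods. -/
theorem ContMDiffAt.map_nhds_eq_of_surj {f : N → M} {x : N} (hf : ContMDiffAt J I 1 f x)
    (hs : Function.Surjective (mfderiv J I f x)) : map f (𝓝 x) = 𝓝 (f x) := by
  set F := writtenInExtChartAt J I x f with hF
  have hc : ContDiffAt ℝ 1 F (extChartAt J x x) := by
    have := (contMDiffAt_iff.mp hf).2
    rwa [J.range_eq_univ, contDiffWithinAt_univ] at this
  obtain ⟨D, hd, hD⟩ : ∃ D : E' →L[ℝ] E,
      HasFDerivWithinAt F D (range J) (extChartAt J x x) ∧ Function.Surjective D :=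
    ⟨mfderiv J I f x, (hf.mdifferentiableAt one_ne_zero).hasMFDerivAt.2, hs⟩
  rw [J.range_eq_univ, hasFDerivWithinAt_univ] at hd
  have hm : map F (𝓝 (extChartAt J x x)) = 𝓝 (F (extChartAt J x x)) := by
    refine (hc.hasStrictFDerivAt one_ne_zero).map_nhds_eq_of_surj ?_
    rw [hd.fderiv]
    exact LinearMap.range_eq_top.mpr hD
  have hFx : F (extChartAt J x x) = extChartAt I (f x) (f x) := by
    simp [hF, writtenInExtChartAt]
  have hsymm := map_extChartAt_symm_nhdsWithin_range (I := I) (f x)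
  rw [I.range_eq_univ, nhdsWithin_univ, ← hFx, ← hm, ← map_extChartAt_nhds_of_boundaryless,
    map_map, map_map] at hsymm
  rw [← hsymm]
  refine map_congr ?_
  filter_upwards [extChartAt_source_mem_nhds (I := J) x,
    hf.continuousAt.preimage_mem_nhds (extChartAt_source_mem_nhds (I := I) (f x))] with y hy hy'
  rw [hF, writtenInExtChartAt, Function.comp_apply, Function.comp_apply, Function.comp_apply,
    Function.comp_apply, (extChartAt J x).left_inv hy, (extChartAt I (f x)).left_inv hy']

end Submersion

/-- A group acting on a connected space transitively, provided that all the orbits are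
neighbourhoods of their points. -/
theorem isPretransitive_of_orbit_mem_nhds {A X : Type*} [Group A] [TopologicalSpace X]
    [ConnectedSpace X] [MulAction A X] (h : ∀ x : X, MulAction.orbit A x ∈ 𝓝 x) :
    MulAction.IsPretransitive A X := by
  have ho (x : X) : IsOpen (MulAction.orbit A x) := isOpen_iff_mem_nhds.mpr fun y hy => by
    rw [← MulAction.orbit_eq_iff.mpr hy]
    exact h y
  -- The complement of an orbit is a union of other orbits, all open.
  have hc (x : X) : IsClosed (MulAction.orbit A x) := by
    refine isOpen_compl_iff.mp (isOpen_iff_mem_nhds.mpr fun y hy => ?_)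
    refine mem_of_superset ((ho y).mem_nhds (MulAction.mem_orbit_self y)) fun z hz hzx => hy ?_
    rw [← MulAction.orbit_eq_iff.mpr hzx, MulAction.orbit_eq_iff.mpr hz]
    exact MulAction.mem_orbit_self y
  refine ⟨fun x y => ?_⟩
  have hu := IsClopen.eq_univ ⟨hc x, ho x⟩ ⟨x, MulAction.mem_orbit_self x⟩
  exact hu.ge (mem_univ y)

/-! ### Integral curves of left-invariant vector fields -/

section IntegralCurve

variable {E : Type*} [NormedAddCommGroup E] [NormedSpace ℝ E]
  {H : Type*} [TopologicalSpace H] {I : ModelWithCorners ℝ E H}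

/-- The velocity of `γ` is `v ∘ γ`, which is continuous; near `t₀` it is read in the trivialization
at `γ t₀`. -/
theorem IsMIntegralCurve.contMDiff_one {M : Type*} [TopologicalSpace M] [ChartedSpace H M]
    [IsManifold I 1 M] {γ : ℝ → M} {v : (x : M) → TangentSpace I x}
    (hγ : IsMIntegralCurve (I := I) γ v)
    (hv : Continuous fun x => (⟨x, v x⟩ : TangentBundle I M)) : ContMDiff 𝓘(ℝ, ℝ) I 1 γ := by
  intro t₀
  rw [contMDiffAt_iff_target, contMDiffAt_iff_contDiffAt, contDiffAt_one_iff]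
  refine ⟨hγ.continuous.continuousAt, ?_⟩
  let e := trivializationAt E (TangentSpace I (M := M)) (γ t₀)
  refine ⟨fun t => (1 : ℝ →L[ℝ] ℝ).smulRight (e ⟨γ t, v (γ t)⟩).2,
    {t | HasDerivAt ((extChartAt I (γ t₀)) ∘ γ)
      (tangentCoordChange I (γ t) (γ t₀) (γ t) (v (γ t))) t} ∩
      γ ⁻¹' (chartAt H (γ t₀)).source, inter_mem (hγ.isMIntegralCurveAt t₀).eventually_hasDerivAt
      (hγ.continuous.continuousAt.preimage_mem_nhds
        ((chartAt H (γ t₀)).open_source.mem_nhds (mem_chart_source H (γ t₀)))), ?_, fun t ht => ?_⟩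
  · have h1 : ContinuousOn (fun t => (e ⟨γ t, v (γ t)⟩).2) (γ ⁻¹' (chartAt H (γ t₀)).source) := by
      refine continuous_snd.comp_continuousOn (e.continuousOn.comp
        (hv.comp hγ.continuous).continuousOn fun t ht => ?_)
      rw [e.mem_source]
      exact ht
    exact ((ContinuousLinearMap.smulRightL ℝ ℝ E 1).continuous.comp_continuousOn h1).mono
      inter_subset_right
  · exact ht.1.hasFDerivAt

end IntegralCurve

section LieGroup

variable {E : Type*} [NormedAddCommGroup E] [NormedSpace ℝ E]
  {H : Type*} [TopologicalSpace H] {J : ModelWithCorners ℝ E H}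
  {G : Type*} [TopologicalSpace G] [ChartedSpace H G] [Group G] [LieGroup J ∞ G]

theorem mfderiv_mul_left_mulInvariantVectorField (ξ : GroupLieAlgebra J G) (g h : G) :
    mfderiv J J (g * ·) h (mulInvariantVectorField ξ h) = mulInvariantVectorField ξ (g * h) := by
  have hd (a b : G) : MDifferentiableAt J J (a * ·) b :=
    (contMDiff_mul_left (I := J) (n := ∞) (a := a)).mdifferentiableAt (by simp)
  have e : (g * h * · : G → G) = (g * ·) ∘ (h * ·) := by
    ext x
    simp [mul_assoc]
  have hd' : MDifferentiableAt J J (g * ·) (h * 1) := hd g (h * 1)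
  rw [mulInvariantVectorField, mulInvariantVectorField, e, mfderiv_comp (1 : G) hd' (hd h 1)]
  -- The base points `h * 1` and `h` agree only propositionally, so the differentials are compared
  -- as maps on the model space.
  have hc : ∀ k : G, k = h → ∀ v : E, (mfderiv J J (g * ·) h : E →L[ℝ] E) v =
      (mfderiv J J (g * ·) k : E →L[ℝ] E) v := by
    rintro _ rfl v
    rfl
  exact hc (h * 1) (mul_one h) _

omit [LieGroup J ∞ G] in
theorem mulInvariantVectorField_one (ξ : GroupLieAlgebra J G) :
    mulInvariantVectorField ξ (1 : G) = ξ := by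
  have e : ((1 : G) * ·) = (id : G → G) := by
    ext x
    simp
  rw [mulInvariantVectorField, e, mfderiv_id]
  rfl

theorem contMDiff_one_mulInvariantVectorField (ξ : GroupLieAlgebra J G) :
    ContMDiff J J.tangent 1 fun g : G => (⟨g, mulInvariantVectorField ξ g⟩ : TangentBundle J G) := by
  have : LieGroup J (minSmoothness ℝ 3) G :=
    LieGroup.of_le (n := ∞) (by
      rw [minSmoothness_of_isRCLikeNormedField]
      exact WithTop.coe_le_coe.mpr le_top)
  exact (contMDiff_mulInvariantVectorField ξ).of_le
    (by simp [minSmoothness_of_isRCLikeNormedField])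

theorem IsMIntegralCurveOn.mul_left {ξ : GroupLieAlgebra J G} {γ : ℝ → G} {s : Set ℝ}
    (hγ : IsMIntegralCurveOn (I := J) γ (mulInvariantVectorField ξ) s) (g : G) :
    IsMIntegralCurveOn (I := J) (fun t => g * γ t) (mulInvariantVectorField ξ) s := by
  intro t ht
  have hd : MDifferentiableAt J J (g * ·) (γ t) :=
    (contMDiff_mul_left (I := J) (n := ∞) (a := g)).mdifferentiableAt (by simp)
  have h := hd.hasMFDerivAt.comp_hasMFDerivWithinAt t (hγ t ht)
  refine h.congr_mfderiv ?_
  rw [← mfderiv_mul_left_mulInvariantVectorField]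
  have hc (D : E →L[ℝ] E) (v : E) : D ∘L (1 : ℝ →L[ℝ] ℝ).smulRight v =
      (1 : ℝ →L[ℝ] ℝ).smulRight (D v) := by
    ext
    simp
  exact hc _ _

/-- Left-invariant vector fields are complete. -/
theorem exists_isMIntegralCurve_mulInvariantVectorField [CompleteSpace E] [J.Boundaryless]
    [T2Space G] (ξ : GroupLieAlgebra J G) :
    ∃ γ : ℝ → G, γ 0 = 1 ∧ IsMIntegralCurve (I := J) γ (mulInvariantVectorField ξ) := by
  have : LieGroup J 1 G := LieGroup.of_le (n := ∞) (by simp)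
  have : IsManifold J 1 G := inferInstance
  have hv := contMDiff_one_mulInvariantVectorField ξ
  obtain ⟨γ, h0, hγ⟩ := exists_isMIntegralCurveAt_of_contMDiffAt_boundaryless 0
    (hv.contMDiffAt (x := (1 : G)))
  obtain ⟨ε, hε, hγ⟩ := isMIntegralCurveAt_iff'.mp hγ
  -- Left translates of the local curve through `1` give every point the same existence time `ε`,
  -- which suffices for global existence.
  refine exists_isMIntegralCurve_of_isMIntegralCurveOn hv hε (fun g => ?_) 1
  refine ⟨fun t => g * γ t, by simp [h0], ?_⟩
  rw [Real.ball_eq_Ioo, zero_sub, zero_add] at hγ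
  exact hγ.mul_left g

omit [LieGroup J ∞ G] in
-- Running `γ` at speed `t` gives an integral curve for `t • ξ`.
theorem IsMIntegralCurve.isLieExp {ξ : GroupLieAlgebra J G} {γ : ℝ → G} (h0 : γ 0 = 1)
    (hγ : IsMIntegralCurve (I := J) γ (mulInvariantVectorField ξ)) (t : ℝ) :
    IsLieExp J (t • ξ) (γ t) :=
  ⟨γ ∘ fun s => s * t, by simp [h0],
    by rw [mulInvariantVectorField_smul]; exact hγ.comp_mul t, by simp⟩

omit [LieGroup J ∞ G] in
theorem contMDiff_list_prod {n : ℕ∞ω} [ContMDiffMul J n G] {E' : Type*} [NormedAddCommGroup E']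
    [NormedSpace ℝ E'] {H' : Type*} [TopologicalSpace H'] {I : ModelWithCorners ℝ E' H'}
    {N : Type*} [TopologicalSpace N] [ChartedSpace H' N] {ι : Type*} {f : ι → N → G}
    (hf : ∀ i, ContMDiff I J n (f i)) (l : List ι) :
    ContMDiff I J n fun x => (l.map fun i => f i x).prod := by
  induction l with
  | nil => simpa using contMDiff_const
  | cons i l ih =>
    simp only [List.map_cons, List.prod_cons]
    exact (hf i).mul ih

end LieGroup

/-! ### Orbits and orbit maps -/

section Homogeneous

variable {E : Type*} [NormedAddCommGroup E] [NormedSpace ℝ E]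
  {H : Type*} [TopologicalSpace H] {I : ModelWithCorners ℝ E H}
  {M : Type*} [TopologicalSpace M] [ChartedSpace H M]
  {E' : Type*} [NormedAddCommGroup E'] [NormedSpace ℝ E']
  {H' : Type*} [TopologicalSpace H'] {J : ModelWithCorners ℝ E' H'}
  {G : Type*} [TopologicalSpace G] [ChartedSpace H' G] [Group G] [MulAction G M]

theorem HasMFDerivAt.congr_point {N : Type*} [TopologicalSpace N] [ChartedSpace H' N] {f : N → M}
    {x y : N} {D : E' →L[ℝ] E} (hf : HasMFDerivAt J I f x D) (h : x = y) :
    HasMFDerivAt J I f y D := by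
  subst h
  exact hf

theorem contMDiff_orbitMap (hs : ContMDiff (J.prod I) I ∞ fun q : G × M => q.1 • q.2) (p : M) :
    ContMDiff J I ∞ fun g : G => g • p :=
  hs.comp (contMDiff_id.prodMk contMDiff_const)

/-- If the differential at the identity of an orbit map is onto already on a subspace `𝔥` of the Lie
algebra, then the orbit under the connected Lie subgroup generated by `exp 𝔥` is a
neighbourhood. -/
theorem orbit_connectedLieSubgroup_mem_nhds [LieGroup J ∞ G] [T2Space G] [J.Boundaryless]
    [I.Boundaryless] [FiniteDimensional ℝ E'] [CompleteSpace E]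
    (hs : ContMDiff (J.prod I) I ∞ fun q : G × M => q.1 • q.2)
    (𝔥 : Submodule ℝ (GroupLieAlgebra J G)) (p : M)
    (hp : ∀ v : E, ∃ ξ ∈ 𝔥, (mfderiv J I (fun g : G => g • p) 1 ξ : E) = v) :
    MulAction.orbit (connectedLieSubgroup J 𝔥) p ∈ 𝓝 p := by
  have : CompleteSpace E' := FiniteDimensional.complete ℝ E'
  have : LieGroup J 1 G := LieGroup.of_le (n := ∞) (by simp)
  have : IsManifold J 1 G := inferInstance
  have : FiniteDimensional ℝ (GroupLieAlgebra J G) := inferInstanceAs (FiniteDimensional ℝ E')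
  have horb : ContMDiff J I 1 fun g : G => g • p := (contMDiff_orbitMap hs p).of_le (by simp)
  let D : E' →L[ℝ] E := mfderiv J I (fun g : G => g • p) 1
  have hD : HasMFDerivAt J I (fun g : G => g • p) (1 : G) D :=
    (horb.mdifferentiable one_ne_zero 1).hasMFDerivAt
  let b := Module.finBasis ℝ 𝔥
  let ι := Fin (Module.finrank ℝ 𝔥)
  choose γ h0 hγ using fun i : ι =>
    exists_isMIntegralCurve_mulInvariantVectorField (b i : GroupLieAlgebra J G)
  have hγ1 (i : ι) : ContMDiff 𝓘(ℝ, ℝ) J 1 (γ i) :=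
    (hγ i).contMDiff_one (contMDiff_one_mulInvariantVectorField _).continuous
  have hmem (i : ι) (t : ℝ) : γ i t ∈ connectedLieSubgroup J 𝔥 :=
    Subgroup.subset_closure ⟨_, 𝔥.smul_mem t (b i).2, (hγ i).isLieExp (h0 i) t⟩
  -- Coordinates of the second kind, `x ↦ ∏ exp (xᵢ bᵢ)` for a basis `b` of `𝔥`.
  let F : (ι → ℝ) → G := fun x => ((List.finRange _).map fun i => γ i (x i)).prod
  have hF : ContMDiff 𝓘(ℝ, ι → ℝ) J 1 F := contMDiff_list_prod (fun i => (hγ1 i).comp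
    (ContinuousLinearMap.proj (R := ℝ) (φ := fun _ : ι => ℝ) i).contDiff.contMDiff) _
  have hFmem (x : ι → ℝ) : F x ∈ connectedLieSubgroup J 𝔥 :=
    Subgroup.list_prod_mem _ fun y hy => by
      obtain ⟨i, -, rfl⟩ := List.mem_map.mp hy
      exact hmem i (x i)
  have hFs (i : ι) (t : ℝ) : F (Pi.single i t) = γ i t := by
    refine (List.prod_map_eq_pow_single i _ fun j hj _ => ?_).trans ?_
    · rw [Pi.single_eq_of_ne hj, h0]
    · rw [Pi.single_eq_same, List.count_eq_one_of_mem (List.nodup_finRange _) (List.mem_finRange i),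
        pow_one]
  have hF0 : F 0 = 1 := by
    refine List.prod_eq_one fun y hy => ?_
    obtain ⟨i, -, rfl⟩ := List.mem_map.mp hy
    exact h0 i
  let f : (ι → ℝ) → M := fun x => F x • p
  have hf : ContMDiff 𝓘(ℝ, ι → ℝ) I 1 f := horb.comp hF
  let Df : (ι → ℝ) →L[ℝ] E := mfderiv 𝓘(ℝ, ι → ℝ) I f 0
  have hDf : HasMFDerivAt 𝓘(ℝ, ι → ℝ) I f (0 : ι → ℝ) Df :=
    (hf.mdifferentiable one_ne_zero 0).hasMFDerivAt
  -- On the `i`-th axis all other factors of `F` are `1`, so `f` restricts to `t ↦ γ i t • p`.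
  have hpart (i : ι) : Df (Pi.single i 1) = D (b i : GroupLieAlgebra J G) := by
    have h1 : HasMFDerivAt 𝓘(ℝ, ℝ) I (f ∘ fun t : ℝ => (Pi.single i t : ι → ℝ)) (0 : ℝ)
        (Df ∘L ContinuousLinearMap.single ℝ (fun _ : ι => ℝ) i) :=
      HasMFDerivAt.comp (0 : ℝ) (hDf.congr_point (Pi.single_zero i).symm)
        (ContinuousLinearMap.single ℝ (fun _ : ι => ℝ) i).hasFDerivAt.hasMFDerivAt
    have h2 : HasMFDerivAt 𝓘(ℝ, ℝ) I ((fun g : G => g • p) ∘ γ i) (0 : ℝ)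
        (D ∘L (1 : ℝ →L[ℝ] ℝ).smulRight
          (mulInvariantVectorField (b i : GroupLieAlgebra J G) (γ i 0) : E')) :=
      HasMFDerivAt.comp (0 : ℝ) (hD.congr_point (h0 i).symm) (hγ i 0)
    have e : (f ∘ fun t : ℝ => (Pi.single i t : ι → ℝ)) = (fun g : G => g • p) ∘ γ i :=
      funext fun t => congrArg (· • p) (hFs i t)
    rw [e] at h1
    have h3 := congrArg (fun A : ℝ →L[ℝ] E => A 1) (hasMFDerivAt_unique h1 h2)
    have e' : ∀ g : G, g = 1 →
        (mulInvariantVectorField (b i : GroupLieAlgebra J G) g : E') = (b i).1 := by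
      rintro _ rfl
      exact mulInvariantVectorField_one _
    refine h3.trans ?_
    change D ((1 : ℝ) • (mulInvariantVectorField (b i : GroupLieAlgebra J G) (γ i 0) : E')) = _
    rw [one_smul, e' _ (h0 i)]
  have hsum : Df.toLinearMap ∘ₗ b.equivFun.toLinearMap =
      (mfderiv J I (fun g : G => g • p) 1).toLinearMap ∘ₗ 𝔥.subtype := by
    refine b.ext fun i => ?_
    refine Eq.trans ?_ (hpart i)
    simp [b.equivFun_apply, Finsupp.single_eq_pi_single]
  have hsurj : Function.Surjective Df := by
    intro v
    obtain ⟨ξ, hξ, rfl⟩ := hp v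
    exact ⟨b.equivFun ⟨ξ, hξ⟩, LinearMap.congr_fun hsum ⟨ξ, hξ⟩⟩
  have hn := (hf.contMDiffAt (x := 0)).map_nhds_eq_of_surj hsurj
  have hf0 : f 0 = p := by
    simp only [f, hF0, one_smul]
  rw [hf0] at hn
  rw [← hn, mem_map]
  exact univ_mem' fun x => ⟨⟨F x, hFmem x⟩, rfl⟩

/-- If an orbit map is a submersion at the identity for every point, then all orbit maps are
submersions. -/
theorem surjective_mfderiv_orbitMap [LieGroup J ∞ G]
    (hs : ∀ p : M, ContMDiff J I ∞ fun g : G => g • p)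
    (h : ∀ p : M, Function.Surjective (mfderiv J I (fun g : G => g • p) 1)) (p : M) (g : G) :
    Function.Surjective (mfderiv J I (fun g : G => g • p) g) := by
  -- Differentiated at `1`, the left side is surjective by `h (g • p)`; hence so is the outer
  -- differential on the right, taken at `g`.
  have e : (fun k : G => k • g • p) = (fun k : G => k • p) ∘ (· * g) := by
    ext k
    simp [mul_smul]
  have hr : MDifferentiableAt J J (· * g) (1 : G) :=
    (contMDiff_mul_right (I := J) (n := ∞) (a := g)).mdifferentiableAt (by simp)
  have ho : HasMFDerivAt J I (fun k : G => k • p) g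
      (mfderiv J I (fun g : G => g • p) g : E' →L[ℝ] E) :=
    ((hs p).mdifferentiable (by simp) g).hasMFDerivAt
  have hc := HasMFDerivAt.comp (1 : G) (ho.congr_point (one_mul g).symm) hr.hasMFDerivAt
  rw [← e] at hc
  have hg := h (g • p)
  rw [hc.mfderiv] at hg
  exact Function.Surjective.of_comp hg

end Homogeneous

end

theorem theorem3p3
    -- the Lie algebra `𝔤` and its `r`-matrix
    {𝔤 : Type*} [LieRing 𝔤] [LieAlgebra ℝ 𝔤] [FiniteDimensional ℝ 𝔤]
    (r : ⋀[ℝ]^2 𝔤) (hr : IsRMatrix r)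
    -- the connected symplectic manifold `(M, Ω)`
    {E : Type*} [NormedAddCommGroup E] [NormedSpace ℝ E] [FiniteDimensional ℝ E]
    {H : Type*} [TopologicalSpace H] (I : ModelWithCorners ℝ E H) [I.Boundaryless]
    {M : Type*} [TopologicalSpace M] [ChartedSpace H M] [IsManifold I ∞ M]
    [T2Space M] [ConnectedSpace M]
    (Ω : (p : M) → TangentSpace I p [⋀^Fin 2]→L[ℝ] ℝ) (hΩ : IsSymplecticForm I Ω)
    -- the Lie group `G`, acting on `M`
    {E' : Type*} [NormedAddCommGroup E'] [NormedSpace ℝ E'] [FiniteDimensional ℝ E']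
    {H' : Type*} [TopologicalSpace H'] (J : ModelWithCorners ℝ E' H') [J.Boundaryless]
    {G : Type*} [TopologicalSpace G] [ChartedSpace H' G] [Group G] [LieGroup J ∞ G]
    [T2Space G] [MulAction G M]
    -- the Lie algebra action `φ`, integrating to the action of `G`
    (φ : 𝔤 →ₗ[ℝ] ((p : M) → TangentSpace I p)) (hφ : IsLieAlgebraAction I φ)
    (e : 𝔤 ≃ₗ[ℝ] GroupLieAlgebra J G) (he : IntegratesTo I J φ e)
    -- the symplectic bivector field is the image of `r`
    (hπ : IsBivectorOf (bivectorImage φ r) Ω) :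
    -- the connected Lie subgroup `G_r` of `G` acts transitively on `M`
    MulAction.IsPretransitive
      (connectedLieSubgroup J ((symplecticSubalgebra r hr).toSubmodule.map e.toLinearMap)) M ∧
    -- and `M` is a homogeneous space for `G_r` as a Lie group
    ∀ {E'' : Type*} [NormedAddCommGroup E''] [NormedSpace ℝ E''] [FiniteDimensional ℝ E'']
      {H'' : Type*} [TopologicalSpace H''] (J' : ModelWithCorners ℝ E'' H'') [J'.Boundaryless]
      {K : Type*} [TopologicalSpace K] [ChartedSpace H'' K] [Group K] [LieGroup J' ∞ K]
      [ConnectedSpace K] (ι : K →* G),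
      IsIntegralOf J J' ι ((symplecticSubalgebra r hr).toSubmodule.map e.toLinearMap) →
      letI : MulAction K M := MulAction.compHom M ι
      IsHomogeneousSpace I J' K M := by
  have : CompleteSpace E := FiniteDimensional.complete ℝ E
  have horb (p : M) : ContMDiff J I ∞ fun g : G => g • p :=
    contMDiff_orbitMap he.contMDiff_smul p
  have hsurj (p : M) (v : E) : ∃ ξ ∈ (symplecticSubalgebra r hr).toSubmodule.map e.toLinearMap,
      (mfderiv J I (fun g : G => g • p) 1 ξ : E) = v := by
    -- The sign offsets the minus in `he.fundamental`.
    obtain ⟨ξ, hξ, h⟩ := exists_mem_symplecticSubalgebra_apply_eq hr hΩ hπ p (-v : E)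
    refine ⟨e ξ, Submodule.mem_map_of_mem hξ, ?_⟩
    exact neg_injective ((he.fundamental ξ p).symm.trans h)
  refine ⟨isPretransitive_of_orbit_mem_nhds fun p =>
    orbit_connectedLieSubgroup_mem_nhds he.contMDiff_smul _ p (hsurj p), ?_⟩
  intro E'' _ _ _ H'' _ J' _ K _ _ _ _ _ ι hι
  let : MulAction K M := MulAction.compHom M ι
  have : CompleteSpace E'' := FiniteDimensional.complete ℝ E''
  have hK : ContMDiff (J'.prod I) I ∞ fun q : K × M => q.1 • q.2 :=
    he.contMDiff_smul.comp ((hι.contMDiff.comp contMDiff_fst).prodMk contMDiff_snd)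
  -- By the chain rule this differential is that of the `G`-orbit map after `dι`, whose image is
  -- `𝔤_r`.
  have h1 (p : M) : Function.Surjective (mfderiv J' I (fun k : K => k • p) 1) := by
    have hG : HasMFDerivAt J I (fun g : G => g • p) (1 : G)
        (mfderiv J I (fun g : G => g • p) 1 : E' →L[ℝ] E) :=
      ((horb p).mdifferentiable (by simp) 1).hasMFDerivAt
    have hc := HasMFDerivAt.comp (1 : K) (hG.congr_point (map_one ι).symm)
      (hι.contMDiff.mdifferentiable (by simp) 1).hasMFDerivAt
    intro v
    obtain ⟨ξ, hξ, h⟩ := hsurj p v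
    obtain ⟨w, hw⟩ := (hι.range_eq ξ).mp hξ
    refine ⟨w, ?_⟩
    have hm : mfderiv J' I (fun k : K => k • p) 1 = _ := hc.mfderiv
    rw [hm]
    exact (congrArg (mfderiv J I (fun g : G => g • p) 1 : E' →L[ℝ] E) hw).trans h
  have hKorb (p : M) : ContMDiff J' I ∞ fun k : K => k • p := contMDiff_orbitMap hK p
  have htrans : MulAction.IsPretransitive K M := isPretransitive_of_orbit_mem_nhds fun p => by
    have hn := (((hKorb p).of_le (by simp)).contMDiffAt (x := (1 : K))).map_nhds_eq_of_surj (h1 p)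
    rw [one_smul] at hn
    rw [← hn, Filter.mem_map]
    exact Filter.univ_mem' fun k => ⟨k, rfl⟩
  exact ⟨hK, htrans.exists_smul_eq, fun p g => surjective_mfderiv_orbitMap hKorb h1 p g⟩
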